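/- Let $D$ be a divisible abelian group, i.e. for every positive integer $n$ and every $x\in D$ there is $y\in D$ with $ny=x$. For a subgroup $H$ of $D$ we use the following terminology. - $H$ is *fully inert* in $D$ if $\varphi(H)\cap H$ has finite index in $\varphi(H)$ (equivalently, $(H+\varphi(H))/H$ is finite) for every endomorphism $\varphi$ of $D$. - $H$ is *uniformly fully inert* in $D$ if there is a natural number $n$ such that $|(H+\varphi(H))/H|\le n$ for every endomorphism $\varphi$ of $D$. - $H$ is *fully invariant* in $D$ if $\varphi(H)\subseteq H$ for every endomorphism $\varphi$ of $D$. - Subgroups $H$ and $K$ of $D$ are *commensurable* if $H\cap K$ has finite index in both $H$ and $K$. Let $r_0(D)$ be the torsion-free rank of $D$, i.e. the cardinality of any maximal independent subset of elements of infinite order of $D$. Theorem. The following conditions are equivalent: 1. every fully inert subgroup of $D$ is commensurable with some fully invariant subgroup of $D$; 2. either $r_0(D)=0$ or $r_0(D)$ is infinite; 3. every fully inert subgroup of $D$ is uniformly fully inert. -/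

import Mathlib

/-- A subgroup `H` of an abelian group `A` is `φ`-inert if `φ(H) ∩ H` has finite index in the
image `φ(H)`. (`H.relIndex K` is the index of `H ∩ K` in `K`, with the value `0` when that index
is infinite.) -/
def AddSubgroup.IsInertUnder {A : Type*} [AddCommGroup A] (H : AddSubgroup A) (φ : A →+ A) :
    Prop :=
  H.relIndex (H.map φ) ≠ 0

/-- A subgroup is fully inert if it is `φ`-inert for all endomorphisms `φ`. -/
def AddSubgroup.IsFullyInert {A : Type*} [AddCommGroup A] (H : AddSubgroup A) : Prop :=
  ∀ φ : A →+ A, H.IsInertUnder φ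

/-- A subgroup `H` is uniformly fully inert if there is a natural number `n` such that
`(H + φ(H)) / H` is finite of order at most `n` for all endomorphisms `φ`. -/
def AddSubgroup.IsUniformlyFullyInert {A : Type*} [AddCommGroup A] (H : AddSubgroup A) : Prop :=
  ∃ n : ℕ, ∀ φ : A →+ A,
    H.relIndex (H ⊔ H.map φ) ≠ 0 ∧ H.relIndex (H ⊔ H.map φ) ≤ n

/-- A subgroup is fully invariant if every endomorphism maps it into itself. -/
def AddSubgroup.IsFullyInvariant {A : Type*} [AddCommGroup A] (H : AddSubgroup A) : Prop :=
  ∀ φ : A →+ A, H.map φ ≤ H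

/-- The torsion-free rank `r₀(A)`: the supremum of the cardinalities of the `ℤ`-linearly
independent subsets of `A` (a set is `ℤ`-linearly independent exactly when it is independent and
all of its elements have infinite order). -/
noncomputable def torsionFreeRank (A : Type*) [AddCommGroup A] : Cardinal :=
  Module.rank ℤ A

namespace AddSubgroup

/-! Divisibility supplies many endomorphisms. For fully inert `H`, some finitely generated `F ≤ H`
makes the `H`-images under endomorphisms killing `F` generate a subgroup `K` almost contained in
`H`: otherwise failures glue to one endomorphism violating inertness. `K` is fully invariant. If `H`
is torsion, `F` is finite and `H` is almost contained in `K`, so the two are commensurable. If `H`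
has an element of infinite order, `D/H` is torsion; infinite rank then lets `H` map onto infinitely
many cosets unless `H = D`. In finite nonzero rank, torsion plus a maximal free subgroup is fully
inert, but sending a basis element `x` to `x/(n+1)` defeats every uniform bound `n`. -/

theorem relIndex_ne_zero_iff_finite_image {A : Type*} [AddCommGroup A] {H L : AddSubgroup A} :
    H.relIndex L ≠ 0 ↔ ((QuotientAddGroup.mk : A → A ⧸ H) '' (L : Set A)).Finite := by
  have h := relIndex_ker L (QuotientAddGroup.mk' H)
  rw [QuotientAddGroup.ker_mk'] at h
  have h2 : ((QuotientAddGroup.mk : A → A ⧸ H) '' (L : Set A))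
      = (L.map (QuotientAddGroup.mk' H) : Set (A ⧸ H)) := rfl
  have : Nonempty (L.map (QuotientAddGroup.mk' H)) := ⟨0⟩
  rw [h, h2, Nat.card_ne_zero, Set.Finite]
  exact ⟨fun h => h.2, fun h => ⟨this, h⟩⟩

theorem relIndex_map_dvd {A B : Type*} [AddCommGroup A] [AddCommGroup B] (f : A →+ B)
    {L H : AddSubgroup A} (h : L ≤ H) : (L.map f).relIndex (H.map f) ∣ L.relIndex H := by
  have h2 : H ⊔ f.ker = H ⊔ (L ⊔ f.ker) := by rw [← sup_assoc, sup_eq_left.2 h]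
  rw [relIndex_map_map, h2, relIndex_sup_right]
  exact relIndex_dvd_of_le_left _ le_sup_left

/-- A subgroup commensurable with a fully invariant one is uniformly fully inert. -/
theorem IsFullyInvariant.isUniformlyFullyInert_of_commensurable {A : Type*} [AddCommGroup A]
    {H K : AddSubgroup A} (hK : K.IsFullyInvariant) (hHK : H.Commensurable K) :
    H.IsUniformlyFullyInert := by
  obtain ⟨h1, h2⟩ := hHK
  refine ⟨H.relIndex K * K.relIndex H, fun φ => ?_⟩
  rw [sup_comm, relIndex_sup_right]
  have h3 : ((H ⊓ K).map φ).relIndex (H.map φ) ∣ K.relIndex H := by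
    have := relIndex_map_dvd φ (inf_le_left : H ⊓ K ≤ H)
    rwa [inf_relIndex_left] at this
  have hle : (H ⊓ K).map φ ≤ K := (map_mono inf_le_right).trans (hK φ)
  have h4 := relIndex_le_of_le_right hle h1
  have h4' : H.relIndex ((H ⊓ K).map φ) ≠ 0 := fun h => h1 (relIndex_eq_zero_of_le_right hle h)
  have h5 := relIndex_inf_mul_relIndex H ((H ⊓ K).map φ) (H.map φ)
  rw [inf_eq_left.2 (map_mono inf_le_left : (H ⊓ K).map φ ≤ H.map φ)] at h5
  have h6 : (H ⊓ (H ⊓ K).map φ).relIndex (H.map φ) ≠ 0 := by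
    rw [← h5]
    exact mul_ne_zero h4' (ne_zero_of_dvd_ne_zero h2 h3)
  refine ⟨fun h => h6 (relIndex_eq_zero_of_le_left inf_le_left h), ?_⟩
  refine (relIndex_le_of_le_left inf_le_left h6).trans ?_
  rw [← h5]
  exact Nat.mul_le_mul h4 (Nat.le_of_dvd (Nat.pos_of_ne_zero h2) h3)

end AddSubgroup

/-! ### Extending homomorphisms into divisible groups -/

section Extension

variable {D : Type*} [AddCommGroup D] [DivisibleBy D ℕ]

theorem baer_of_divisibleBy_nat : Module.Baer ℤ D := by
  let := AddGroup.divisibleByIntOfDivisibleByNat D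
  exact Module.Baer.of_divisible D

/-- For `x` of infinite order, `addOrderOf x = 0`: the condition on `y` is vacuous and `ZMod 0` is
`ℤ`. -/
theorem exists_addMonoidHom_apply_eq {N : Type*} [AddCommGroup N] (x : N) (y : D)
    (h : addOrderOf x • y = 0) : ∃ φ : N →+ D, φ x = y := by
  let n := addOrderOf x
  let f : ZMod n →+ N := ZMod.lift n ⟨zmultiplesHom N x, by simp [n]⟩
  let g : ZMod n →+ D := ZMod.lift n ⟨zmultiplesHom D y, by simpa [n] using h⟩
  have hf : Function.Injective f := by
    rw [ZMod.lift_injective]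
    intro m hm
    rw [CharP.intCast_eq_zero_iff (ZMod n) n]
    exact addOrderOf_dvd_iff_zsmul_eq_zero.2 hm
  obtain ⟨φ, hφ⟩ := baer_of_divisibleBy_nat.extension_property_addMonoidHom f hf g
  refine ⟨φ, ?_⟩
  have h1 : f ((1 : ℤ) : ZMod n) = x := by simp [f, -Int.cast_one]
  have h2 : g ((1 : ℤ) : ZMod n) = y := by simp [g, -Int.cast_one]
  rw [← h1, ← h2, ← hφ]
  rfl

theorem exists_end_apply_eq_of_le_ker (F : AddSubgroup D) (x y : D)
    (h : addOrderOf (x : D ⧸ F) • y = 0) : ∃ φ : D →+ D, F ≤ φ.ker ∧ φ x = y := by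
  obtain ⟨φ, hφ⟩ := exists_addMonoidHom_apply_eq (x : D ⧸ F) y h
  refine ⟨φ.comp (QuotientAddGroup.mk' F), fun z hz => ?_, hφ⟩
  simp [AddMonoidHom.mem_ker, (QuotientAddGroup.eq_zero_iff z).2 hz]

theorem exists_addMonoidHom_of_linearIndependent {N ι : Type*} [AddCommGroup N] {v : ι → N}
    (hv : LinearIndependent ℤ v)
    (y : ι → D) : ∃ φ : N →+ D, ∀ i, φ (v i) = y i := by
  obtain ⟨φ, hφ⟩ := baer_of_divisibleBy_nat.extension_property
    (Finsupp.linearCombination ℤ v) hv (Finsupp.linearCombination ℤ y)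
  refine ⟨φ.toAddMonoidHom, fun i => ?_⟩
  simpa using LinearMap.congr_fun hφ (Finsupp.single i 1)

/-- A compatible sequence of homomorphisms on an increasing chain of subgroups of a divisible
group is induced by one endomorphism. -/
theorem exists_end_eq_on_chain {F : ℕ → AddSubgroup D} (hF : Monotone F) (ψ : ℕ → D →+ D)
    (hψ : ∀ m n, m ≤ n → ∀ y ∈ F m, ψ n y = ψ m y) :
    ∃ θ : D →+ D, ∀ n, ∀ y ∈ F n, θ y = ψ n y := by
  let p : ℕ → (D →ₗ.[ℤ] D) := fun n =>
    ⟨(F n).toIntSubmodule, (ψ n).toIntLinearMap.domRestrict _⟩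
  have hp : Monotone p := by
    intro m n hmn
    refine ⟨fun y hy => hF hmn hy, ?_⟩
    rintro ⟨x, hx⟩ ⟨y, hy⟩ rfl
    exact (hψ m n hmn x hx).symm
  have hdir : DirectedOn (· ≤ ·) (Set.range p) := directedOn_range.2 hp.directed_le
  obtain ⟨θ, hθ⟩ := baer_of_divisibleBy_nat.extension_property
    (LinearPMap.sSup _ hdir).domain.subtype Subtype.val_injective (LinearPMap.sSup _ hdir).toFun
  refine ⟨θ.toAddMonoidHom, fun n y hy => ?_⟩
  have hle := LinearPMap.le_sSup hdir (Set.mem_range_self n)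
  have h1 := LinearMap.congr_fun hθ ⟨y, hle.1 hy⟩
  exact h1.trans (hle.2 (x := ⟨y, hy⟩) (y := ⟨y, hle.1 hy⟩) rfl).symm

end Extension

/-! ### The trace of endomorphisms vanishing on a subgroup -/

namespace AddSubgroup

/-- The subgroup generated by the images of `H` under the endomorphisms vanishing on `F`. -/
def vanishingTrace {A : Type*} [AddCommGroup A] (H F : AddSubgroup A) : AddSubgroup A :=
  ⨆ φ : {φ : A →+ A // F ≤ φ.ker}, H.map φ.1

section Trace

variable {A : Type*} [AddCommGroup A] {H F : AddSubgroup A}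

theorem map_le_vanishingTrace {φ : A →+ A} (hφ : F ≤ φ.ker) : H.map φ ≤ H.vanishingTrace F :=
  le_iSup (fun φ : {φ : A →+ A // F ≤ φ.ker} => H.map φ.1) ⟨φ, hφ⟩

theorem isFullyInvariant_vanishingTrace : (H.vanishingTrace F).IsFullyInvariant := by
  intro θ
  rw [vanishingTrace, map_iSup]
  refine iSup_le fun φ => ?_
  rw [map_map]
  refine map_le_vanishingTrace (φ := θ.comp φ.1) fun x hx => ?_
  have : φ.1 x = 0 := φ.2 hx
  simp [AddMonoidHom.mem_ker, this]

end Trace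

section Divisible

variable {D : Type*} [AddCommGroup D] [DivisibleBy D ℕ] {H : AddSubgroup D}

theorem IsFullyInert.exists_fg_relIndex_vanishingTrace_ne_zero (hH : H.IsFullyInert) :
    ∃ F ≤ H, F.FG ∧ H.relIndex (H.vanishingTrace F) ≠ 0 := by
  by_contra! hcon
  have step : ∀ s : {F : AddSubgroup D // F ≤ H ∧ F.FG} × (D →+ D), ∃ x φ, x ∈ H ∧
      s.1.1 ≤ AddMonoidHom.ker φ ∧ φ x ∉ H ⊔ H.map s.2 := by
    rintro ⟨⟨F, hFH, hF⟩, ψ⟩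
    -- Otherwise the trace lies in `H + ψ(H)`, where `H` has finite index.
    by_contra! hc
    have hle : H.vanishingTrace F ≤ H ⊔ H.map ψ := by
      refine iSup_le fun φ => ?_
      rintro _ ⟨x, hx, rfl⟩
      exact hc x φ.1 hx φ.2
    have h1 : H.relIndex (H ⊔ H.map ψ) ≠ 0 := by
      rw [sup_comm, relIndex_sup_right]
      exact hH ψ
    exact h1 (relIndex_eq_zero_of_le_right hle (hcon F hFH hF))
  choose X Φ hX hΦ hXΦ using step
  let s : ℕ → {F : AddSubgroup D // F ≤ H ∧ F.FG} × (D →+ D) := fun n =>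
    Nat.rec (⟨⊥, bot_le, ⟨∅, by simp⟩⟩, 0) (fun _ s => (⟨s.1.1 ⊔ zmultiples (X s),
      sup_le s.1.2.1 (by simpa using hX s), s.1.2.2.sup ⟨{X s}, by simp [zmultiples_eq_closure]⟩⟩,
      s.2 + Φ s)) n
  have hF1 : ∀ n, (s (n + 1)).1.1 = (s n).1.1 ⊔ zmultiples (X (s n)) := fun n => rfl
  have hψ1 : ∀ n, (s (n + 1)).2 = (s n).2 + Φ (s n) := fun n => rfl
  have hmono : Monotone fun n => (s n).1.1 :=
    monotone_nat_of_le_succ fun n => by rw [hF1]; exact le_sup_left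
  have hcompat : ∀ m n, m ≤ n → ∀ y ∈ (s m).1.1, (s n).2 y = (s m).2 y := by
    intro m n hmn y hy
    induction n, hmn using Nat.le_induction with
    | base => rfl
    | succ n hmn ih =>
      have : Φ (s n) y = 0 := hΦ (s n) (hmono hmn hy)
      simp [hψ1, this, ih]
  have hxF : ∀ n, X (s n) ∈ (s (n + 1)).1.1 := fun n => by
    rw [hF1]; exact mem_sup_right (mem_zmultiples _)
  obtain ⟨θ, hθ⟩ := exists_end_eq_on_chain hmono (fun n => (s n).2) hcompat
  have hsep : ∀ i j, i < j → (θ (X (s i)) : D ⧸ H) ≠ (θ (X (s j)) : D ⧸ H) := by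
    intro i j hij heq
    rw [QuotientAddGroup.eq] at heq
    have h1 : θ (X (s i)) = (s j).2 (X (s i)) := hθ j _ (hmono hij (hxF i))
    have h2 : θ (X (s j)) = (s j).2 (X (s j)) + Φ (s j) (X (s j)) := by
      rw [hθ (j + 1) _ (hxF j), hψ1]; rfl
    -- If `θ` sent `x_i` and `x_j` to one coset, `φ_j(x_j)` would lie in `H + ψ_j(H)`, against its
    -- choice.
    refine hXΦ (s j) ?_
    have h3 : Φ (s j) (X (s j)) = (-θ (X (s i)) + θ (X (s j))) +
        ((s j).2 (X (s i)) - (s j).2 (X (s j))) := by rw [h1, h2]; abel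
    rw [h3, ← map_sub]
    exact add_mem (mem_sup_left heq)
      (mem_sup_right (mem_map_of_mem _ (sub_mem (hX _) (hX _))))
  have hinj : Function.Injective fun n => (θ (X (s n)) : D ⧸ H) := by
    intro i j hij
    rcases lt_trichotomy i j with h | h | h
    · exact (hsep i j h hij).elim
    · exact h
    · exact (hsep j i h hij.symm).elim
  refine Set.infinite_range_of_injective hinj
    ((relIndex_ne_zero_iff_finite_image.1 (hH θ)).subset ?_)
  rintro _ ⟨n, rfl⟩
  exact ⟨_, mem_map_of_mem θ (hX (s n)), rfl⟩

end Divisible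

end AddSubgroup

/-! ### Torsion subgroups -/

theorem finite_setOf_nsmul_eq_zero {G : Type*} [AddCommGroup G]
    (h : ∀ p : ℕ, p.Prime → {g : G | p • g = 0}.Finite) {n : ℕ} (hn : n ≠ 0) :
    {g : G | n • g = 0}.Finite := by
  induction n using Nat.recOnMul with
  | zero => exact (hn rfl).elim
  | one => simp
  | prime p hp => exact h p hp
  | mul a b iha ihb =>
    have ha := iha (left_ne_zero_of_mul hn)
    have hb := ihb (right_ne_zero_of_mul hn)
    have : {g : G | (a * b) • g = 0} = (fun g => b • g) ⁻¹' {g | a • g = 0} := by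
      ext g; simp [mul_smul]
    rw [this]
    refine ha.preimage' fun c _ => ?_
    by_cases hc : ∃ g, b • g = c
    · obtain ⟨g, rfl⟩ := hc
      refine (hb.image (fun z => g + z)).subset fun z hz => ⟨z - g, ?_, by simp⟩
      have hz : b • z = b • g := hz
      simp [smul_sub, hz]
    · refine Set.finite_empty.subset fun g hg => (hc ⟨g, hg⟩).elim

namespace AddSubgroup

section Divisible

variable {D : Type*} [AddCommGroup D] [DivisibleBy D ℕ] {H F : AddSubgroup D}

theorem mem_vanishingTrace_of_nsmul_eq_zero {x y : D} (hx : x ∈ H)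
    (h : addOrderOf (x : D ⧸ F) • y = 0) : y ∈ H.vanishingTrace F := by
  obtain ⟨φ, hφ, rfl⟩ := exists_end_apply_eq_of_le_ker F x y h
  exact map_le_vanishingTrace hφ (mem_map_of_mem φ hx)

theorem finite_image_primary_vanishingTrace [Finite F] {p : ℕ} (hp : p.Prime) :
    ((QuotientAddGroup.mk : D → D ⧸ H.vanishingTrace F) ''
      {x | x ∈ H ∧ ∃ j : ℕ, p ^ j • x = 0}).Finite := by
  have : Fact p.Prime := ⟨hp⟩
  -- Modulo `F`, `x` has order `p ^ i` with `i > k`, so it can be sent to any `y` killed by `p ^ (k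
  -- + 1)`.
  have key : ∀ k : ℕ, (∃ x ∈ H, (∃ j : ℕ, p ^ j • x = 0) ∧ p ^ k • x ∉ F) →
      ∀ y : D, p ^ (k + 1) • y = 0 → y ∈ H.vanishingTrace F := by
    rintro k ⟨x, hx, ⟨j, hj⟩, hk⟩ y hy
    have h1 : p ^ j • (x : D ⧸ F) = 0 := by
      rw [← QuotientAddGroup.mk_nsmul, hj]; rfl
    obtain ⟨i, -, hi⟩ := (Nat.dvd_prime_pow hp).1 (addOrderOf_dvd_of_nsmul_eq_zero h1)
    have hki : k < i := by
      by_contra! hik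
      refine hk ((QuotientAddGroup.eq_zero_iff _).1 ?_)
      rw [QuotientAddGroup.mk_nsmul, ← addOrderOf_dvd_iff_nsmul_eq_zero, hi]
      exact pow_dvd_pow p hik
    refine mem_vanishingTrace_of_nsmul_eq_zero hx ?_
    obtain ⟨c, hc⟩ := pow_dvd_pow p (Nat.succ_le_of_lt hki)
    rw [hi, hc, mul_comm, mul_smul, hy, smul_zero]
  by_cases hb : ∃ k : ℕ, ∀ x ∈ H, (∃ j : ℕ, p ^ j • x = 0) → p ^ k • x ∈ F
  · classical
    have hk := Nat.find_spec hb
    set k := Nat.find hb with hkdef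
    have hK : ∀ y : D, p ^ k • y = 0 → y ∈ H.vanishingTrace F := by
      intro y hy
      rcases Nat.eq_zero_or_pos k with h0 | hpos
      · rw [h0] at hy
        have : y = 0 := by simpa using hy
        rw [this]; exact zero_mem _
      · have hmin := Nat.find_min hb (m := k - 1) (by omega)
        push Not at hmin
        refine key (k - 1) ?_ y (by rwa [Nat.sub_add_cancel hpos])
        obtain ⟨x, hx, hj, hxF⟩ := hmin
        exact ⟨x, hx, hj, hxF⟩
    set P := {x | x ∈ H ∧ ∃ j : ℕ, p ^ j • x = 0}
    have hrep : ∀ t : D ⧸ H.vanishingTrace F, ∃ x : D, t ∈ QuotientAddGroup.mk '' P →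
        x ∈ P ∧ (x : D ⧸ H.vanishingTrace F) = t := by
      intro t
      by_cases ht : t ∈ (QuotientAddGroup.mk : D → D ⧸ H.vanishingTrace F) '' P
      · obtain ⟨x, hx, rfl⟩ := ht
        exact ⟨x, fun _ => ⟨hx, rfl⟩⟩
      · exact ⟨0, fun h => (ht h).elim⟩
    choose r hr using hrep
    -- Multiplication by `p ^ k` maps representatives into the finite `F`; by minimality of `k`, its
    -- kernel lies in the trace.
    refine Set.Finite.of_injOn (f := fun t => p ^ k • r t) (t := (F : Set D)) ?_ ?_
      (Set.toFinite _)
    · intro t ht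
      exact hk _ (hr t ht).1.1 (hr t ht).1.2
    · intro t ht t' ht' heq
      rw [← (hr t ht).2, ← (hr t' ht').2, QuotientAddGroup.eq]
      refine hK _ ?_
      have heq : p ^ k • r t = p ^ k • r t' := heq
      rw [smul_add, smul_neg, heq, neg_add_cancel]
  · push Not at hb
    refine (Set.finite_singleton 0).subset ?_
    rintro _ ⟨y, ⟨-, j, hj⟩, rfl⟩
    refine (QuotientAddGroup.eq_zero_iff _).2 (key j ?_ y
      (by rw [pow_succ', mul_smul, hj, smul_zero]))
    obtain ⟨x, hx, hj, hxF⟩ := hb j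
    exact ⟨x, hx, hj, hxF⟩

theorem vanishingTrace_relIndex_ne_zero [Finite F] (hH : ∀ x ∈ H, IsOfFinAddOrder x) :
    (H.vanishingTrace F).relIndex H ≠ 0 := by
  set K := H.vanishingTrace F with hKdef
  have he : Nat.card F ≠ 0 := Nat.card_pos.ne'
  have heK : ∀ x ∈ H, Nat.card F • x ∈ K := by
    intro x hx
    let φ : D →+ D := nsmulAddMonoidHom (Nat.card F)
    have hφ : F ≤ φ.ker := fun y hy => by
      exact congrArg Subtype.val (card_nsmul_eq_zero' (x := (⟨y, hy⟩ : F)))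
    exact map_le_vanishingTrace hφ (mem_map_of_mem φ hx)
  rw [relIndex_ne_zero_iff_finite_image]
  let G := H.map (QuotientAddGroup.mk' K)
  have hG : {g : G | Nat.card F • g = 0}.Finite := by
    refine finite_setOf_nsmul_eq_zero (fun p hp => ?_) he
    refine Set.Finite.of_finite_image ((finite_image_primary_vanishingTrace (H := H) (F := F)
      hp).subset ?_) Subtype.val_injective.injOn
    rintro _ ⟨⟨_, x, hx, rfl⟩, hpx, rfl⟩
    have hpx : p • x ∈ K := by
      have := congrArg Subtype.val hpx
      exact (QuotientAddGroup.eq_zero_iff _).1 this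
    obtain ⟨j, m, hm, hjm⟩ := Nat.exists_eq_pow_mul_and_not_dvd (hH x hx).addOrderOf_pos.ne' p
      hp.ne_one
    -- Bézout splits `x` into a `p`-primary element of `H` and a multiple of `p • x`, which lies in
    -- `K`.
    have hcop : IsCoprime (p : ℤ) (m : ℤ) :=
      Nat.isCoprime_iff_coprime.2 ((Nat.Prime.coprime_iff_not_dvd hp).2 hm)
    obtain ⟨a, b, hab⟩ := hcop
    refine ⟨b • m • x, ⟨zsmul_mem (nsmul_mem hx _) _, j, ?_⟩, ?_⟩
    · rw [smul_comm, smul_smul (p ^ j), ← hjm, addOrderOf_nsmul_eq_zero, smul_zero]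
    · refine QuotientAddGroup.eq.2 ?_
      have : -(b • m • x) + x = a • p • x := by
        nth_rw 2 [← one_smul ℤ x]
        rw [← hab, add_smul, mul_smul, mul_smul, natCast_zsmul, natCast_zsmul]
        abel
      rw [this]
      exact zsmul_mem hpx _
  refine (hG.image Subtype.val).subset ?_
  rintro _ ⟨x, hx, rfl⟩
  refine ⟨⟨_, mem_map_of_mem (QuotientAddGroup.mk' K) hx⟩, ?_, rfl⟩
  exact Subtype.ext ((QuotientAddGroup.eq_zero_iff _).2 (heK x hx))

/-- A torsion fully inert subgroup of a divisible group is commensurable with a fully invariant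
subgroup. -/
theorem IsFullyInert.exists_isFullyInvariant_commensurable_of_torsion (hH : H.IsFullyInert)
    (ht : ∀ x ∈ H, IsOfFinAddOrder x) :
    ∃ K : AddSubgroup D, K.IsFullyInvariant ∧ H.Commensurable K := by
  obtain ⟨F, hFH, hF, hind⟩ := hH.exists_fg_relIndex_vanishingTrace_ne_zero
  have : AddGroup.FG F := (AddGroup.fg_iff_addSubgroup_fg F).2 hF
  have : Finite F := AddCommGroup.finite_of_fg_isAddTorsion F fun x =>
    AddSubmonoid.isOfFinAddOrder_coe.1 (ht _ (hFH x.2))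
  exact ⟨_, isFullyInvariant_vanishingTrace, hind, vanishingTrace_relIndex_ne_zero ht⟩

/-- In a divisible group, a fully inert subgroup which is not torsion has torsion quotient. -/
theorem IsFullyInert.exists_nsmul_mem (hH : H.IsFullyInert) {x : D} (hx : x ∈ H)
    (hx0 : ¬ IsOfFinAddOrder x) (y : D) : ∃ n : ℕ, n ≠ 0 ∧ n • y ∈ H := by
  obtain ⟨φ, rfl⟩ := exists_addMonoidHom_apply_eq x y
    (by rw [addOrderOf_eq_zero hx0, zero_smul])
  have hfin : IsOfFinAddOrder (φ x : D ⧸ H) := by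
    by_contra hinf
    refine Set.infinite_range_of_injective (injective_nsmul_iff_not_isOfFinAddOrder.2 hinf)
      ((relIndex_ne_zero_iff_finite_image.1 (hH φ)).subset (Set.range_subset_iff.2 fun n => ?_))
    exact ⟨_, nsmul_mem (mem_map_of_mem φ hx) n, rfl⟩
  exact ⟨addOrderOf (φ x : D ⧸ H), hfin.addOrderOf_pos.ne', (QuotientAddGroup.eq_zero_iff _).1
    (by rw [QuotientAddGroup.mk_nsmul, addOrderOf_nsmul_eq_zero])⟩

/-- A finite divisible group is killed by its order, hence zero. -/
theorem eq_top_of_finite_quotient [Finite (D ⧸ H)] : H = ⊤ := by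
  refine eq_top_iff.2 fun x _ => ?_
  have hn : Nat.card (D ⧸ H) ≠ 0 := Nat.card_pos.ne'
  rw [← DivisibleBy.div_cancel x hn, ← QuotientAddGroup.eq_zero_iff, QuotientAddGroup.mk_nsmul]
  exact card_nsmul_eq_zero'

theorem IsFullyInert.eq_top_of_aleph0_le_rank (hH : H.IsFullyInert) {x : D} (hx : x ∈ H)
    (hx0 : ¬ IsOfFinAddOrder x) (hr : Cardinal.aleph0 ≤ Module.rank ℤ D) : H = ⊤ := by
  obtain ⟨s, hs, hli⟩ := exists_set_linearIndependent_of_isDomain ℤ D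
  rw [← hs, Cardinal.aleph0_le_mk_iff] at hr
  let e : ℕ ↪ s := Infinite.natEmbedding s
  have hv : LinearIndependent ℤ fun n => (e n : D) :=
    LinearIndependent.comp (v := fun i : s => (i : D)) hli e e.injective
  choose m hm0 hm using fun n => hH.exists_nsmul_mem hx hx0 (e n : D)
  by_contra hne
  have : Infinite (D ⧸ H) := by
    by_contra hfin
    rw [not_infinite_iff_finite] at hfin
    exact hne eq_top_of_finite_quotient
  let c : ℕ ↪ D ⧸ H := Infinite.natEmbedding _
  obtain ⟨φ, hφ⟩ := exists_addMonoidHom_of_linearIndependent hv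
    fun n => DivisibleBy.div (c n).out (m n)
  refine Set.infinite_range_of_injective c.injective
    ((relIndex_ne_zero_iff_finite_image.1 (hH φ)).subset ?_)
  rintro _ ⟨n, rfl⟩
  refine ⟨φ (m n • (e n : D)), mem_map_of_mem φ (hm n), ?_⟩
  rw [map_nsmul, hφ, DivisibleBy.div_cancel _ (hm0 n)]
  exact Quotient.out_eq' _

end Divisible

/-! ### The counterexample in finite rank -/

/-- In a divisible group of finite nonzero torsion-free rank, there is a fully inert subgroup that
is not uniformly fully inert. -/
theorem exists_isFullyInert_not_isUniformlyFullyInert {D : Type*} [AddCommGroup D]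
    [DivisibleBy D ℕ] (h0 : Module.rank ℤ D ≠ 0) (hfin : Module.rank ℤ D < Cardinal.aleph0) :
    ∃ H : AddSubgroup D, H.IsFullyInert ∧ ¬ H.IsUniformlyFullyInert := by
  obtain ⟨s, hli, hmax⟩ := exists_maximal_linearIndepOn ℤ (id : D → D)
  have hs : Finite s := by
    rw [← Cardinal.lt_aleph0_iff_finite]
    exact (LinearIndependent.cardinal_le_rank hli).trans_lt hfin
  let T : AddSubgroup D := AddCommGroup.torsion D
  let S : AddSubgroup D := AddSubgroup.closure s
  have htor : ∀ y : D, ∃ a : ℤ, a ≠ 0 ∧ a • y ∈ S := by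
    intro y
    by_cases hy : y ∈ s
    · exact ⟨1, one_ne_zero, zsmul_mem (subset_closure hy) 1⟩
    · obtain ⟨a, ha, h⟩ := hmax y hy
      refine ⟨a, ha, ?_⟩
      rw [Set.image_id, ← Submodule.mem_toAddSubgroup,
        Submodule.span_int_eq_addSubgroupClosure] at h
      exact h
  have hT : ∀ φ : D →+ D, T.map φ ≤ T := by
    rintro φ _ ⟨y, hy, rfl⟩
    exact φ.isOfFinAddOrder hy
  refine ⟨T ⊔ S, fun φ => ?_, ?_⟩
  · have hle : (T ⊔ S).map φ ≤ (T ⊔ S) ⊔ S.map φ := by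
      rw [map_sup]
      exact sup_le_sup ((hT φ).trans le_sup_left) le_rfl
    have hSφ : (T ⊔ S).relIndex (S.map φ) ≠ 0 := by
      have hfg : (((S.map φ).map (QuotientAddGroup.mk' (T ⊔ S)))).FG := by
        classical
        have := Fintype.ofFinite s
        exact ⟨(s.toFinset.image φ).image (QuotientAddGroup.mk' (T ⊔ S)), by
          simp [S, AddMonoidHom.map_closure]⟩
      rw [relIndex_ne_zero_iff_finite_image]
      have : AddGroup.FG ((S.map φ).map (QuotientAddGroup.mk' (T ⊔ S))) :=
        (AddGroup.fg_iff_addSubgroup_fg _).2 hfg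
      refine (AddCommGroup.finite_of_fg_isAddTorsion
        ((S.map φ).map (QuotientAddGroup.mk' (T ⊔ S))) ?_ :)
      rintro ⟨_, y, -, rfl⟩
      obtain ⟨a, ha, hay⟩ := htor y
      rw [isOfFinAddOrder_iff_zsmul_eq_zero]
      exact ⟨a, ha, Subtype.ext ((QuotientAddGroup.eq_zero_iff _).2 (mem_sup_right hay))⟩
    refine fun h => hSφ ?_
    have h2 := relIndex_eq_zero_of_le_right hle h
    rwa [sup_comm _ (S.map φ), relIndex_sup_right] at h2
  · rintro ⟨n, hn⟩
    have hne : s.Nonempty := by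
      by_contra! hse
      refine h0 (rank_eq_zero_iff.2 fun y => ?_)
      obtain ⟨a, ha, hay⟩ := htor y
      refine ⟨a, ha, ?_⟩
      simpa [S, hse] using hay
    obtain ⟨x, hx⟩ := hne
    let z : D := DivisibleBy.div x (n + 1)
    have hz : (n + 1) • z = x := DivisibleBy.div_cancel x n.succ_ne_zero
    have hv : LinearIndependent ℤ fun i : s => (i : D) := hli
    have hxo : addOrderOf x = 0 := by
      rw [addOrderOf_eq_zero_iff, isOfFinAddOrder_iff_zsmul_eq_zero]
      rintro ⟨a, ha, hax⟩
      exact ha (Finsupp.single_eq_zero.1 (linearIndependent_iff.1 hv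
        (Finsupp.single ⟨x, hx⟩ a) (by simpa using hax)))
    obtain ⟨φ, hφ⟩ := exists_addMonoidHom_apply_eq x z (by rw [hxo, zero_smul])
    obtain ⟨hne, hle⟩ := hn φ
    set M := (T ⊔ S) ⊔ (T ⊔ S).map φ
    have hzM : z ∈ M := by
      rw [← hφ]
      exact mem_sup_right (mem_map_of_mem φ (mem_sup_right (subset_closure hx)))
    have hmem : (T ⊔ S).relIndex M • z ∈ T ⊔ S :=
      nsmul_relIndex_mem _ hzM
    classical
    let : DivisibleBy ℚ ℕ := AddGroup.divisibleByNatOfDivisibleByInt ℚ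
    -- The `x`-coordinate `π` is integral on `T ⊔ S` while `π z = 1/(n+1)`, so `n + 1` divides the
    -- index.
    obtain ⟨π, hπ⟩ := exists_addMonoidHom_of_linearIndependent (D := ℚ) hv
      (Pi.single ⟨x, hx⟩ 1)
    have hint : T ⊔ S ≤ (Int.castAddHom ℚ).range.comap π := by
      refine sup_le (fun t ht => ⟨0, ?_⟩) ((closure_le _).2 fun i hi => ?_)
      · obtain ⟨a, ha, hat⟩ := isOfFinAddOrder_iff_zsmul_eq_zero.1 ht
        have h1 : a • π t = 0 := by rw [← map_zsmul, hat, map_zero]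
        simpa [ha] using ((smul_eq_zero.1 h1).resolve_left ha).symm
      · by_cases hix : (⟨i, hi⟩ : s) = ⟨x, hx⟩
        · exact ⟨1, by rw [hπ ⟨i, hi⟩, hix]; simp⟩
        · exact ⟨0, by rw [hπ ⟨i, hi⟩]; simp [hix]⟩
    obtain ⟨c, hc⟩ := hint hmem
    have hπz : ((n : ℚ) + 1) * π z = 1 := by
      have h1 : π x = 1 := (hπ ⟨x, hx⟩).trans (Pi.single_eq_same _ _)
      rw [← hz, map_nsmul, nsmul_eq_mul] at h1
      exact_mod_cast h1
    have hk : (((T ⊔ S).relIndex M : ℤ) : ℚ) = ((n + 1 : ℤ) * c : ℤ) := by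
      have h1 : (c : ℚ) = ((T ⊔ S).relIndex M : ℚ) * π z := by
        rw [← nsmul_eq_mul, ← map_nsmul]; exact hc
      push_cast
      rw [h1, mul_left_comm, hπz, mul_one]
    have hdvd : n + 1 ∣ (T ⊔ S).relIndex M := by
      exact_mod_cast Dvd.intro c (Int.cast_injective hk).symm
    have := Nat.le_of_dvd (Nat.pos_of_ne_zero hne) hdvd
    omega

end AddSubgroup

theorem mainTheorem1 (D : Type*) [AddCommGroup D] [DivisibleBy D ℕ] :
    List.TFAE
      [∀ H : AddSubgroup D, H.IsFullyInert →
          ∃ K : AddSubgroup D, K.IsFullyInvariant ∧ H.Commensurable K,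
        torsionFreeRank D = 0 ∨ Cardinal.aleph0 ≤ torsionFreeRank D,
        ∀ H : AddSubgroup D, H.IsFullyInert → H.IsUniformlyFullyInert] := by
  tfae_have 1 → 3 := by
    intro h H hH
    obtain ⟨K, hK, hHK⟩ := h H hH
    exact hK.isUniformlyFullyInert_of_commensurable hHK
  tfae_have 3 → 2 := by
    intro h
    by_contra! hr
    obtain ⟨H, hH, hH'⟩ := AddSubgroup.exists_isFullyInert_not_isUniformlyFullyInert hr.1 hr.2
    exact hH' (h H hH)
  tfae_have 2 → 1 := by
    intro hr H hH
    by_cases ht : ∀ x ∈ H, IsOfFinAddOrder x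
    · exact hH.exists_isFullyInvariant_commensurable_of_torsion ht
    · push Not at ht
      obtain ⟨x, hx, hx0⟩ := ht
      rcases hr with hr | hr
      · obtain ⟨a, ha, hax⟩ := rank_eq_zero_iff.1 hr x
        exact (hx0 (isOfFinAddOrder_iff_zsmul_eq_zero.2 ⟨a, ha, hax⟩)).elim
      · refine ⟨H, fun φ => ?_, AddSubgroup.Commensurable.refl H⟩
        rw [hH.eq_top_of_aleph0_le_rank hx hx0 hr]
        exact le_top
  tfae_finish
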